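/- There are an algorithm $A$ and a constant $C$ such that $A$ is a deterministic algorithm in the CONGEST model, runs on every $n$-node network $G$ ($n\ge 1$, simple and undirected, not necessarily connected) and for every parameter $s\in\mathbb N$, $s\ge 1$, in at most $C\cdot s$ rounds, and distinguishes connected graphs from graphs that are $\Omega((n\log n)/s)$-stochastically-far from connected, in the following sense. Model. Computation proceeds in synchronous rounds; in each round every node may send a message to each of its neighbours. Every node has a unique identifier of $O(\log n)$ bits and initially knows $n$, $s$, its identifier and its degree; all messages have $O(\log n)$ bits, with a constant that depends only on the constant in the length of the identifiers. On halting, each node accepts or rejects. Stochastic distance. Let $\bar E$ be the set of non-edges of $G=(V,E)$. For $0\le t\le|\bar E|$ let $\mathrm{Add}(G,t)$ be the random graph obtained from $G$ by adding each edge of $\bar E$ independently with probability $t/|\bar E|$. Fix a constant $c>1$. The graph $G$ is $t$-stochastically-far from connected if $G$ is disconnected and $\Pr[\mathrm{Add}(G,t)\text{ is not connected}]>n^{-c}$. Guarantee. If $G$ is connected, then all nodes accept. For every $c>1$ there is a constant $K>0$, depending only on $c$, such that if $G$ is $t$-stochastically-far from connected for some $t$ with $K\,(n\log n)/s\le t\le|\bar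 E|$, then at least one node rejects. -/

import Mathlib

/-! ### The CONGEST model -/

/-- A deterministic synchronous message-passing algorithm: one program, run by every node.
`State d` is the set of local states of a node with `d` incident edges, which the node tells apart
by the port numbers `0, …, d - 1`. Messages are bit strings; the empty string stands for silence.
Local computation is unrestricted, as is usual in the model. -/
structure CongestAlgorithm where
  State : ℕ → Type
  /-- The initial state of a node of degree `d`, which knows the number `n` of nodes, the
  parameter `s`, and its own identifier `ident`. -/
  init : (d n s ident : ℕ) → State d
  /-- The message sent through each port in the current round. -/
  send : {d : ℕ} → State d → Fin d → List Bool
  /-- The new state, after the messages of the current round have arrived. -/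
  receive : {d : ℕ} → State d → (Fin d → List Bool) → State d
  /-- `none` while the node is still running; `some true` when it has halted and accepts;
  `some false` when it has halted and rejects. -/
  output : {d : ℕ} → State d → Option Bool

/-- A communication network on the graph `G`: every node has a unique identifier, and numbers its
incident edges by ports (in an arbitrary way; a node does not know in advance whom a port leads
to). -/
structure Network {V : Type*} (G : SimpleGraph V) where
  ident : V → ℕ
  ident_injective : Function.Injective ident
  deg : V → ℕ
  port : (v : V) → Fin (deg v) ≃ G.neighborSet v

namespace CongestAlgorithm

variable {V : Type*} {G : SimpleGraph V}

/-- The messages sent in one round by the nodes in the given states. A node that has halted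
sends nothing. -/
def outbox (A : CongestAlgorithm) (N : Network G) (σ : (v : V) → A.State (N.deg v))
    (v : V) (i : Fin (N.deg v)) : List Bool :=
  if (A.output (σ v)).isSome then [] else A.send (σ v) i

/-- The messages that arrive in that round: through port `i`, leading to the neighbour `u`, the
node `v` receives what `u` sends through its port leading to `v`. -/
def inbox (A : CongestAlgorithm) (N : Network G) (σ : (v : V) → A.State (N.deg v))
    (v : V) (i : Fin (N.deg v)) : List Bool :=
  A.outbox N σ (N.port v i) ((N.port (N.port v i)).symm ⟨v, (N.port v i).2.symm⟩)

/-- The states of all nodes after `r` rounds. A node that has halted keeps its state. -/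
def config (A : CongestAlgorithm) (N : Network G) (n s : ℕ) : ℕ → (v : V) → A.State (N.deg v)
  | 0, v => A.init (N.deg v) n s (N.ident v)
  | r + 1, v =>
    let σ := A.config N n s r
    if (A.output (σ v)).isSome then σ v else A.receive (σ v) (A.inbox N σ v)

/-- Every node halts within `T` rounds. -/
def HaltsWithin (A : CongestAlgorithm) (N : Network G) (n s T : ℕ) : Prop :=
  ∀ v, (A.output (A.config N n s T v)).isSome

/-- Every message sent during the execution has at most `b` bits. -/
def MessagesAtMost (A : CongestAlgorithm) (N : Network G) (n s b : ℕ) : Prop :=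
  ∀ r v i, (A.outbox N (A.config N n s r) v i).length ≤ b

/-- At time `T` the node `v` has halted and accepts. -/
def Accepts (A : CongestAlgorithm) (N : Network G) (n s T : ℕ) (v : V) : Prop :=
  A.output (A.config N n s T v) = some true

/-- At time `T` the node `v` has halted and rejects. -/
def Rejects (A : CongestAlgorithm) (N : Network G) (n s T : ℕ) (v : V) : Prop :=
  A.output (A.config N n s T v) = some false

end CongestAlgorithm

/-! ### Stochastic distance -/

/-- The number of non-edges of `G`. -/
noncomputable def numNonEdges {V : Type*} (G : SimpleGraph V) : ℕ := Gᶜ.edgeSet.ncard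

/-- The law of the random graph `Add(G, t)`, obtained from `G` by adding every non-edge
independently with probability `t / numNonEdges G`. It is meant for `0 ≤ t ≤ numNonEdges G`;
outside this range the probability is truncated to `[0, 1]`. -/
noncomputable def randomAdd {V : Type*} (G : SimpleGraph V) (t : ℝ) :
    MeasureTheory.Measure (SimpleGraph V) :=
  (ProbabilityTheory.setBernoulli Gᶜ.edgeSet
    (Set.projIcc (0 : ℝ) 1 zero_le_one (t / numNonEdges G))).map
      fun S => G ⊔ SimpleGraph.fromEdgeSet S

/-- `G`, a graph without the (monotone) property `P`, is `t`-stochastically-close to `P`, with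
error exponent `c`: `Add(G, t)` fails to have `P` with probability at most `n ^ (-c)`. -/
def StochasticallyClose {V : Type*} (c : ℝ) (P : SimpleGraph V → Prop) (G : SimpleGraph V)
    (t : ℝ) : Prop :=
  ¬ P G ∧ (randomAdd G t).real {H | ¬ P H} ≤ (Nat.card V : ℝ) ^ (-c)

/-- `G` is `t`-stochastically-far from `P`: it neither has `P` nor is `t`-stochastically-close
to `P`. -/
def StochasticallyFar {V : Type*} (c : ℝ) (P : SimpleGraph V → Prop) (G : SimpleGraph V)
    (t : ℝ) : Prop :=
  ¬ P G ∧ ¬ StochasticallyClose c P G t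

/-! A graph that is far from connected has a component with fewer than `s` vertices, and gossip
detects such a component in `2 * s` rounds. Detection: identifiers travel pipelined, so an
identifier at distance `d` is delayed only by `d` plus the number of other identifiers learned
(`lt_length_add_card_known`). In a connected graph every node thus collects `min (s + 1) n`
identifiers, whereas no node ever learns more than its own component. Distance: suppose all
components have at least `s` vertices. If the random graph is disconnected, some `k ≥ 1` components
with at most `n / 2` vertices in total receive no outgoing edge. Their cut has at least `k * s * n /
2` pairs, so this has probability at most `n ^ (-(c + 2) * k)`, and a union bound over families of
components gives `n ^ (-c)` (`randomAdd_real_not_connected_le_rpow`). -/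

/-! ### Gossiping identifiers -/

/-- The local state of the gossip algorithm: the number of completed rounds, the number of nodes,
the parameter, the identifiers known so far and those already forwarded to the neighbours. -/
structure GossipState where
  round : ℕ
  order : ℕ
  param : ℕ
  known : Finset ℕ
  sent : Finset ℕ

namespace GossipState

/-- The identifier to be forwarded next: the smallest one that is known but not yet sent. -/
def next (σ : GossipState) : Option ℕ :=
  if h : (σ.known \ σ.sent).Nonempty then some ((σ.known \ σ.sent).min' h) else none

theorem mem_known_of_next {σ : GossipState} {x : ℕ} (h : σ.next = some x) : x ∈ σ.known := by
  unfold next at h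
  split_ifs at h with hne
  have := Finset.min'_mem _ hne
  rw [Option.some.inj h] at this
  exact (Finset.mem_sdiff.1 this).1

theorem notMem_sent_of_next {σ : GossipState} {x : ℕ} (h : σ.next = some x) : x ∉ σ.sent := by
  unfold next at h
  split_ifs at h with hne
  have := Finset.min'_mem _ hne
  rw [Option.some.inj h] at this
  exact (Finset.mem_sdiff.1 this).2

theorem known_subset_sent {σ : GossipState} (h : σ.next = none) : σ.known ⊆ σ.sent := by
  unfold next at h
  split_ifs at h with hne
  exact Finset.sdiff_eq_empty_iff_subset.1 (Finset.not_nonempty_iff_eq_empty.1 hne)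

/-- An optional identifier as a message: a start bit followed by the binary expansion. -/
def encode : Option ℕ → List Bool
  | none => []
  -- The start bit separates the identifier `0`, whose expansion is empty, from silence.
  | some x => true :: x.bits

/-- The content of a message. -/
def decode : List Bool → Option ℕ
  | [] => none
  | _ :: l => some (l.foldr Nat.bit 0)

theorem foldr_bit_bits (x : ℕ) : x.bits.foldr Nat.bit 0 = x := by
  induction x using Nat.binaryRec' with
  | zero => simp
  | bit b n h ih => rw [Nat.bits_append_bit n b h, List.foldr_cons, ih]

@[simp] theorem decode_encode (o : Option ℕ) : decode (encode o) = o := by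
  cases o with
  | none => rfl
  | some x => simp [encode, decode, foldr_bit_bits]

/-- The state after receiving the messages `m`. -/
def step (σ : GossipState) {d : ℕ} (m : Fin d → List Bool) : GossipState where
  round := σ.round + 1
  order := σ.order
  param := σ.param
  known := σ.known ∪ Finset.univ.biUnion fun i => (decode (m i)).toFinset
  sent := σ.sent ∪ σ.next.toFinset

/-- After `2 * param` rounds, accept if more than `param` identifiers or all of them are known. -/
def verdict (σ : GossipState) : Option Bool :=
  if σ.round < 2 * σ.param then none
  else some (decide (min (σ.param + 1) σ.order ≤ σ.known.card))

theorem verdict_eq_none {σ : GossipState} : σ.verdict = none ↔ σ.round < 2 * σ.param := by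
  unfold verdict
  split_ifs <;> simp_all

theorem mem_known_step {σ : GossipState} {d : ℕ} {m : Fin d → List Bool} {x : ℕ} :
    x ∈ (σ.step m).known ↔ x ∈ σ.known ∨ ∃ i, decode (m i) = some x := by
  simp [step]

end GossipState

/-- Every node forwards, one per round, the identifiers it knows. After `2 * s` rounds it accepts
if it knows more than `s` identifiers or all `n` of them. -/
def gossip : CongestAlgorithm where
  State _ := GossipState
  init _ n s ident := ⟨0, n, s, {ident}, ∅⟩
  send σ _ := GossipState.encode σ.next
  receive σ m := σ.step m
  output σ := σ.verdict

namespace gossip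

variable {V : Type*} {G : SimpleGraph V} (N : Network G) (n s : ℕ)

/-- The state of a node after `r` rounds. -/
def state (r : ℕ) (v : V) : GossipState := gossip.config N n s r v

/-- The messages received by a node after `r` rounds. -/
def received (r : ℕ) (v : V) (i : Fin (N.deg v)) : List Bool :=
  if (state N n s r (N.port v i)).verdict.isSome then []
  else GossipState.encode (state N n s r (N.port v i)).next

theorem state_succ (r : ℕ) (v : V) :
    state N n s (r + 1) v =
      if (state N n s r v).verdict.isSome then state N n s r v
      else (state N n s r v).step (received N n s r v) := rfl

theorem order_param_state (r : ℕ) (v : V) :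
    (state N n s r v).order = n ∧ (state N n s r v).param = s := by
  induction r with
  | zero => exact ⟨rfl, rfl⟩
  | succ r ih =>
    rw [state_succ]
    split_ifs
    · exact ih
    · exact ih

theorem round_state {r : ℕ} (hr : r ≤ 2 * s) (v : V) : (state N n s r v).round = r := by
  induction r with
  | zero => rfl
  | succ r ih =>
    have h : (state N n s r v).verdict = none := by
      rw [GossipState.verdict_eq_none, ih (by omega), (order_param_state N n s r v).2]
      omega
    rw [state_succ, h]
    simpa [GossipState.step] using ih (by omega)

theorem verdict_of_lt {r : ℕ} (hr : r < 2 * s) (v : V) :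
    (state N n s r v).verdict = none := by
  rw [GossipState.verdict_eq_none, round_state N n s hr.le, (order_param_state N n s r v).2]
  exact hr

theorem verdict_two_mul (v : V) :
    (state N n s (2 * s) v).verdict =
      some (decide (min (s + 1) n ≤ (state N n s (2 * s) v).known.card)) := by
  rw [GossipState.verdict, round_state N n s le_rfl v, (order_param_state N n s (2 * s) v).1,
    (order_param_state N n s (2 * s) v).2, if_neg (lt_irrefl _)]

theorem state_succ_of_lt {r : ℕ} (hr : r < 2 * s) (v : V) :
    state N n s (r + 1) v = (state N n s r v).step (received N n s r v) := by
  rw [state_succ, verdict_of_lt N n s hr]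
  simp

/-- Every node knows only identifiers of nodes of its own component. -/
theorem exists_reachable_of_mem_known {r : ℕ} {v : V} {x : ℕ}
    (hx : x ∈ (state N n s r v).known) : ∃ w, G.Reachable v w ∧ N.ident w = x := by
  induction r generalizing v x with
  | zero => exact ⟨v, .rfl, (Finset.mem_singleton.1 hx).symm⟩
  | succ r ih =>
    rw [state_succ] at hx
    split_ifs at hx
    · exact ih hx
    · rcases GossipState.mem_known_step.1 hx with hx | ⟨i, hx⟩
      · exact ih hx
      · unfold received at hx
        split_ifs at hx
        · simp [GossipState.decode] at hx
        · rw [GossipState.decode_encode] at hx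
          obtain ⟨w, hw, rfl⟩ := ih (GossipState.mem_known_of_next hx)
          exact ⟨w, (SimpleGraph.Adj.reachable (N.port v i).2).trans hw, rfl⟩

/-! ### Progress of the pipeline -/

theorem sent_succ {r : ℕ} (hr : r < 2 * s) (v : V) :
    (state N n s (r + 1) v).sent =
      (state N n s r v).sent ∪ (state N n s r v).next.toFinset := by
  rw [state_succ_of_lt N n s hr]
  rfl

theorem known_subset_succ (r : ℕ) (v : V) :
    (state N n s r v).known ⊆ (state N n s (r + 1) v).known := by
  rw [state_succ]
  split_ifs
  · rfl
  · exact fun x hx => GossipState.mem_known_step.2 (.inl hx)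

theorem mem_known_succ_of_adj {r : ℕ} (hr : r < 2 * s) {u v : V} (h : G.Adj v u) {x : ℕ}
    (hx : (state N n s r u).next = some x) : x ∈ (state N n s (r + 1) v).known := by
  rw [state_succ_of_lt N n s hr, GossipState.mem_known_step]
  refine .inr ⟨(N.port v).symm ⟨u, h⟩, ?_⟩
  simp [received, verdict_of_lt N n s hr, hx]

/-- Delivery takes no extra round: an identifier enters `sent` in the same round in which it enters
the neighbours' `known`. -/
theorem sent_subset_known_of_adj {r : ℕ} (hr : r ≤ 2 * s) {u v : V} (h : G.Adj v u) :
    (state N n s r u).sent ⊆ (state N n s r v).known := by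
  induction r with
  | zero => exact Finset.empty_subset _
  | succ r ih =>
    rw [sent_succ N n s hr]
    refine Finset.union_subset ((ih (by omega)).trans (known_subset_succ N n s r v)) ?_
    intro x hx
    exact mem_known_succ_of_adj N n s hr h (Option.mem_toFinset.1 hx)

theorem ident_mem_known (r : ℕ) (v : V) : N.ident v ∈ (state N n s r v).known := by
  induction r with
  | zero => exact Finset.mem_singleton_self _
  | succ r ih => exact known_subset_succ N n s r v ih

/-- A node that is still missing an identifier at distance `d` has been learning: every round
after the first `d` has brought it a new identifier. -/
theorem lt_length_add_card_known {v w : V} (p : G.Walk v w) {r : ℕ} (hr : r ≤ 2 * s)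
    (hw : N.ident w ∉ (state N n s r v).known) :
    r < p.length + (state N n s r v).known.card := by
  induction p generalizing r with
  | nil => exact absurd (ident_mem_known N n s r _) hw
  | @cons v u w h q ih =>
    -- The neighbour `u` is one step closer to `w`. While it forwards, its `sent` grows by one per
    -- round; when it is silent, `known ⊆ sent` and the bound along `q` applies. The extra `1` pays
    -- for crossing the edge.
    have key : ∀ r ≤ 2 * s, N.ident w ∉ (state N n s r u).sent →
        r < q.length + 1 + (state N n s r u).sent.card := by
      intro r
      induction r with
      | zero => omega
      | succ r ihr =>
        intro hr hw
        rw [sent_succ N n s hr] at hw ⊢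
        have hw' : N.ident w ∉ (state N n s r u).sent :=
          fun h => hw (Finset.mem_union_left _ h)
        cases hx : (state N n s r u).next with
        | some x =>
          have hcard : ((state N n s r u).sent ∪ (some x).toFinset).card =
              (state N n s r u).sent.card + 1 := by
            rw [Option.toFinset_some, Finset.union_comm, ← Finset.insert_eq,
              Finset.card_insert_of_notMem (GossipState.notMem_sent_of_next hx)]
          have := ihr (by omega) hw'
          omega
        | none =>
          have hsub := GossipState.known_subset_sent hx
          have h1 := ih (by omega) fun hk => hw' (hsub hk)
          have h2 := Finset.card_le_card hsub
          simp only [Option.toFinset_none, Finset.union_empty]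
          omega
    have hsub := sent_subset_known_of_adj N n s hr h
    have h1 := key r hr fun hk => hw (hsub hk)
    have h2 := Finset.card_le_card hsub
    rw [SimpleGraph.Walk.length_cons]
    omega

/-- After `2 * s` rounds in a connected network, every node knows more than `s` identifiers, or
all of them. -/
theorem min_le_card_known [Fintype V] (hG : G.Connected) (v : V) :
    min (s + 1) (Fintype.card V) ≤ (state N n s (2 * s) v).known.card := by
  classical
  by_contra! hlt
  obtain ⟨w, hw⟩ : ∃ w, N.ident w ∉ (state N n s (2 * s) v).known := by
    by_contra! hall
    have : Fintype.card V ≤ (state N n s (2 * s) v).known.card := by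
      rw [← Finset.card_univ]
      exact Finset.card_le_card_of_injOn N.ident (fun w _ => hall w) N.ident_injective.injOn
    omega
  obtain ⟨p, hp⟩ := (hG.preconnected v w).exists_isPath
  -- With at most `s` identifiers known, this forces `p` to be longer than `s`. Its first `s + 1`
  -- vertices are within `s` steps, and missing one of them would require `2 * s < s + s`.
  have hlen := lt_length_add_card_known N n s p le_rfl hw
  have : (Finset.range (s + 1)).card ≤ (state N n s (2 * s) v).known.card := by
    refine Finset.card_le_card_of_injOn (fun j => N.ident (p.getVert j)) (fun j hj => ?_) ?_
    · by_contra hmiss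
      have := lt_length_add_card_known N n s (p.take j) le_rfl hmiss
      have hj' : (p.take j).length ≤ j := by
        rw [SimpleGraph.Walk.take_length]; exact min_le_left _ _
      have := Finset.mem_range.1 hj
      omega
    · intro i hi j hj hij
      have hi' := Finset.mem_range.1 hi
      have hj' := Finset.mem_range.1 hj
      exact hp.getVert_injOn (show i ≤ p.length by omega) (show j ≤ p.length by omega)
        (N.ident_injective hij)
  rw [Finset.card_range] at this
  omega

/-! ### Halting, message length and verdicts -/

theorem card_known_le (r : ℕ) (v : V) [Finite V] :
    (state N n s r v).known.card ≤ (G.connectedComponentMk v).supp.ncard := by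
  rw [← Set.ncard_coe_finset]
  refine (Set.ncard_le_ncard (t := N.ident '' (G.connectedComponentMk v).supp) ?_
    (Set.toFinite _)).trans (Set.ncard_image_le (Set.toFinite _))
  intro x hx
  obtain ⟨w, hw, rfl⟩ := exists_reachable_of_mem_known N n s hx
  exact ⟨w, SimpleGraph.ConnectedComponent.sound hw.symm, rfl⟩

theorem haltsWithin : gossip.HaltsWithin N n s (2 * s) := fun v =>
  Option.isSome_iff_exists.2 ⟨_, verdict_two_mul N n s v⟩

theorem messagesAtMost {b : ℕ} (hb : ∀ v, (N.ident v).size ≤ b) :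
    gossip.MessagesAtMost N n s (b + 1) := by
  intro r v i
  unfold CongestAlgorithm.outbox
  split_ifs
  · exact Nat.zero_le _
  · change (GossipState.encode (state N n s r v).next).length ≤ b + 1
    cases hx : (state N n s r v).next with
    | none => exact Nat.zero_le _
    | some x =>
      obtain ⟨w, -, rfl⟩ :=
        exists_reachable_of_mem_known N n s (GossipState.mem_known_of_next hx)
      simpa [GossipState.encode, Nat.size_eq_bits_len] using hb w

theorem accepts [Fintype V] (hG : G.Connected) (v : V) :
    gossip.Accepts N (Fintype.card V) s (2 * s) v :=
  (verdict_two_mul N _ s v).trans <| by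
    rw [decide_eq_true (min_le_card_known N _ s hG v)]

theorem rejects [Finite V] {v : V} (hs : (G.connectedComponentMk v).supp.ncard ≤ s)
    (hn : (G.connectedComponentMk v).supp.ncard < n) : gossip.Rejects N n s (2 * s) v :=
  (verdict_two_mul N n s v).trans <| by
    have := card_known_le N n s (2 * s) v
    rw [decide_eq_false (by omega)]

end gossip

/-! ### Random edges connect large components -/

open MeasureTheory in
/-- A `p`-random subset of `u` avoids `D ⊆ u` with probability `(1 - p) ^ |D|`. -/
theorem setBernoulli_real_disjoint {ι : Type*} [Countable ι] (u : Set ι) (p : unitInterval)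
    (D : Finset ι) (hD : ↑D ⊆ u) :
    (ProbabilityTheory.setBernoulli u p).real {T | Disjoint T ↑D} = (1 - p : ℝ) ^ D.card := by
  -- In the product space, avoiding `D` is a box: the coordinates in `D` are `False`.
  have hpre : (fun q : ι → Prop => {i | q i}) ⁻¹' {T : Set ι | Disjoint T ↑D} =
      Set.pi D fun _ => {False} := by
    ext q
    simp only [Set.mem_preimage, Set.mem_ofPred_eq, Set.disjoint_right, Set.mem_pi,
      Set.mem_singleton_iff, eq_iff_iff, iff_false]
  have h : ∀ i ∈ D, (unitInterval.toNNReal p • Measure.dirac (i ∈ u) +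
      unitInterval.toNNReal (unitInterval.symm p) • Measure.dirac False : Measure Prop) {False} =
      unitInterval.toNNReal (unitInterval.symm p) := by
    intro i hi
    have : i ∈ u := hD hi
    simp [this]
  rw [measureReal_def, ProbabilityTheory.setBernoulli_apply', hpre,
    Measure.infinitePi_pi _ (fun _ _ => .of_discrete), Finset.prod_congr rfl h]
  simp

/-- Summed over all subsets, the powers give `(1 + x) ^ m ≤ exp (m * x)`, and `exp y - 1 ≤ 2 * y`
for `0 ≤ y ≤ 1`. This evaluates the union bound over nonempty families of components. -/
theorem sum_pow_card_erase_empty_le {ι : Type*} [Fintype ι] [DecidableEq ι] {x : ℝ} (hx : 0 ≤ x)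
    (h : Fintype.card ι * x ≤ 1) :
    ∑ S ∈ (Finset.univ : Finset (Finset ι)).erase ∅, x ^ S.card ≤ 2 * (Fintype.card ι * x) := by
  set y : ℝ := Fintype.card ι * x with hy
  have hy0 : 0 ≤ y := by positivity
  calc ∑ S ∈ (Finset.univ : Finset (Finset ι)).erase ∅, x ^ S.card
      = (x + 1) ^ Fintype.card ι - 1 := by
        rw [Finset.sum_erase_eq_sub (Finset.mem_univ _), Finset.card_empty, pow_zero,
          ← Fintype.sum_pow_mul_eq_add_pow]
        simp
    _ ≤ Real.exp y - 1 := by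
        rw [hy, Real.exp_nat_mul]
        exact sub_le_sub_right (pow_le_pow_left₀ (by linarith) (Real.add_one_le_exp x) _) 1
    _ ≤ 2 * y := by
        have := Real.abs_exp_sub_one_le (x := y) (by rwa [abs_of_nonneg hy0])
        rw [abs_of_nonneg hy0] at this
        exact (le_abs_self _).trans this

/-! ### Cuts between unions of components, and the union bound -/

section Cut

open scoped Classical

variable {V : Type*} [Fintype V] (G : SimpleGraph V)

/-- The vertices of the given components. -/
noncomputable def componentVerts (S : Finset G.ConnectedComponent) : Finset V :=
  Finset.univ.filter fun v => G.connectedComponentMk v ∈ S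

/-- The pairs of a vertex in one of the given components and a vertex outside of them. -/
noncomputable def componentCut (S : Finset G.ConnectedComponent) : Finset (Sym2 V) :=
  (componentVerts G S ×ˢ (componentVerts G S)ᶜ).image fun q => s(q.1, q.2)

variable {G}

theorem mem_componentVerts {S : Finset G.ConnectedComponent} {v : V} :
    v ∈ componentVerts G S ↔ G.connectedComponentMk v ∈ S := by
  simp [componentVerts]

theorem card_componentCut (S : Finset G.ConnectedComponent) :
    (componentCut G S).card =
      (componentVerts G S).card * (Fintype.card V - (componentVerts G S).card) := by
  rw [componentCut, Finset.card_image_of_injOn, Finset.card_product, Finset.card_compl]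
  rintro ⟨a, b⟩ hab ⟨c, d⟩ hcd h
  simp only [Finset.coe_product, Set.mem_prod, Finset.mem_coe, Finset.mem_compl] at hab hcd
  rcases Sym2.eq_iff.1 h with ⟨rfl, rfl⟩ | ⟨rfl, rfl⟩
  · rfl
  · exact absurd hab.1 hcd.2

theorem componentCut_subset (S : Finset G.ConnectedComponent) :
    ↑(componentCut G S) ⊆ Gᶜ.edgeSet := by
  intro e he
  obtain ⟨⟨a, b⟩, hab, rfl⟩ := Finset.mem_image.1 (Finset.mem_coe.1 he)
  rw [Finset.mem_product, Finset.mem_compl, mem_componentVerts, mem_componentVerts] at hab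
  rw [SimpleGraph.mem_edgeSet, SimpleGraph.compl_adj]
  refine ⟨fun h => hab.2 (h ▸ hab.1), fun h => hab.2 ?_⟩
  rw [← SimpleGraph.ConnectedComponent.connectedComponentMk_eq_of_adj h]
  exact hab.1

theorem mul_card_le_card_componentVerts {s : ℕ}
    (hs : ∀ C : G.ConnectedComponent, s ≤ C.supp.ncard) (S : Finset G.ConnectedComponent) :
    s * S.card ≤ (componentVerts G S).card := by
  refine Finset.mul_card_image_le_card_of_maps_to (f := G.connectedComponentMk)
    (fun v hv => mem_componentVerts.1 hv) s fun C hC => ?_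
  refine (hs C).trans_eq ?_
  rw [← Set.ncard_coe_finset]
  congr 1
  ext v
  simp only [SimpleGraph.ConnectedComponent.mem_supp_iff, Finset.coe_filter, Set.mem_ofPred_eq,
    mem_componentVerts]
  exact ⟨fun h => ⟨h ▸ hC, h⟩, fun h => h.2⟩

/-- A disconnected supergraph of `G` has no edge between some components of `G`, together holding
at most half of the vertices, and the others. -/
theorem exists_disjoint_componentCut [Nonempty V] {H : SimpleGraph V} (hGH : G ≤ H)
    (hH : ¬ H.Connected) :
    ∃ S : Finset G.ConnectedComponent, S.Nonempty ∧
      2 * (componentVerts G S).card ≤ Fintype.card V ∧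
      Disjoint H.edgeSet ↑(componentCut G S) := by
  have hpre : ¬ H.Preconnected := fun h => hH ⟨h⟩
  simp only [SimpleGraph.Preconnected, not_forall] at hpre
  obtain ⟨u, v, huv⟩ := hpre
  -- Since `G ≤ H`, the `H`-component of `w` is a union of `G`-components; these form `S w`. Of two
  -- distinct `H`-components, the smaller has at most half of the vertices.
  let S : V → Finset G.ConnectedComponent := fun w =>
    (Finset.univ.filter (H.Reachable w)).image G.connectedComponentMk
  have hS : ∀ w x, x ∈ componentVerts G (S w) ↔ H.Reachable w x := by
    intro w x
    simp only [S, mem_componentVerts, Finset.mem_image, Finset.mem_filter, Finset.mem_univ,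
      true_and]
    constructor
    · rintro ⟨y, hy, hyx⟩
      exact hy.trans ((SimpleGraph.ConnectedComponent.exact hyx).mono hGH)
    · exact fun h => ⟨x, h, rfl⟩
  have hgood : ∀ w, (S w).Nonempty ∧ Disjoint H.edgeSet ↑(componentCut G (S w)) := by
    intro w
    refine ⟨⟨_, mem_componentVerts.1 ((hS w w).2 .rfl)⟩, ?_⟩
    rw [Set.disjoint_right]
    intro e he he'
    obtain ⟨⟨a, b⟩, hab, rfl⟩ := Finset.mem_image.1 (Finset.mem_coe.1 he)
    rw [Finset.mem_product, Finset.mem_compl, hS, hS] at hab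
    exact hab.2 (hab.1.trans (SimpleGraph.Adj.reachable he'))
  have hdisj : Disjoint (componentVerts G (S u)) (componentVerts G (S v)) := by
    rw [Finset.disjoint_left]
    intro x hx hx'
    rw [hS] at hx hx'
    exact huv (hx.trans hx'.symm)
  have hcard := Finset.card_le_univ (componentVerts G (S u) ∪ componentVerts G (S v))
  rw [Finset.card_union_of_disjoint hdisj] at hcard
  rcases le_total (componentVerts G (S u)).card (componentVerts G (S v)).card with h | h
  · exact ⟨S u, (hgood u).1, by omega, (hgood u).2⟩
  · exact ⟨S v, (hgood v).1, by omega, (hgood v).2⟩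

theorem two_mul_numNonEdges_le (G : SimpleGraph V) :
    2 * numNonEdges G ≤ Fintype.card V ^ 2 := by
  have h := Gᶜ.card_edgeFinset_le_card_choose_two
  rw [numNonEdges, ← SimpleGraph.coe_edgeFinset, Set.ncard_coe_finset]
  rw [Nat.choose_two_right] at h
  have h1 := Nat.div_mul_le_self (Fintype.card V * (Fintype.card V - 1)) 2
  have h2 : Fintype.card V * (Fintype.card V - 1) ≤ Fintype.card V * Fintype.card V :=
    Nat.mul_le_mul_left _ (Nat.sub_le _ _)
  rw [sq]
  omega

theorem randomAdd_real_not_connected_le [Nonempty V] (G : SimpleGraph V) (t : ℝ) :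
    (randomAdd G t).real {H | ¬ H.Connected} ≤
      ∑ S : Finset G.ConnectedComponent with
        S.Nonempty ∧ 2 * (componentVerts G S).card ≤ Fintype.card V,
        (1 - Set.projIcc (0 : ℝ) 1 zero_le_one (t / numNonEdges G) : ℝ) ^
          (componentCut G S).card := by
  set p := Set.projIcc (0 : ℝ) 1 zero_le_one (t / numNonEdges G)
  have hmeas : MeasurableSet {H : SimpleGraph V | ¬ H.Connected} := by
    rw [← SimpleGraph.measurableEmbedding_edgeSet.measurableSet_image]
    exact .of_discrete
  rw [randomAdd, MeasureTheory.map_measureReal_apply .of_discrete hmeas]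
  have hsub : (fun T => G ⊔ SimpleGraph.fromEdgeSet T) ⁻¹' {H | ¬ H.Connected} ⊆
      ⋃ S ∈ Finset.univ.filter fun S : Finset G.ConnectedComponent =>
        S.Nonempty ∧ 2 * (componentVerts G S).card ≤ Fintype.card V,
        {T : Set (Sym2 V) | Disjoint T ↑(componentCut G S)} := by
    intro T hT
    obtain ⟨S, hne, hcard, hS⟩ := exists_disjoint_componentCut le_sup_left hT
    simp only [Set.mem_iUnion]
    refine ⟨S, by simp [hne, hcard], ?_⟩
    rw [Set.mem_ofPred_eq, Set.disjoint_right]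
    intro e he heT
    refine Set.disjoint_right.1 hS he ?_
    rw [SimpleGraph.edgeSet_sup, SimpleGraph.edgeSet_fromEdgeSet]
    exact .inr ⟨heT, SimpleGraph.not_isDiag_of_mem_edgeSet _ (componentCut_subset S he)⟩
  refine (MeasureTheory.measureReal_mono hsub (MeasureTheory.measure_ne_top _ _)).trans
    ((MeasureTheory.measureReal_biUnion_finset_le _ _).trans_eq ?_)
  exact Finset.sum_congr rfl fun S _ => setBernoulli_real_disjoint _ _ _ (componentCut_subset S)

/-- The probability that random edges avoid the cut around some components, each of at least `s`
vertices and together at most half of the vertices. -/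
theorem one_sub_pow_card_componentCut_le {s : ℕ}
    (hcomp : ∀ C : G.ConnectedComponent, s ≤ C.supp.ncard) {q k : ℝ} (hq0 : 0 ≤ q) (hq1 : q ≤ 1)
    (hV : 0 < (Fintype.card V : ℝ))
    (hqn : 2 * k * Real.log (Fintype.card V) ≤ q * (s * Fintype.card V))
    (S : Finset G.ConnectedComponent) (hS : 2 * (componentVerts G S).card ≤ Fintype.card V) :
    (1 - q) ^ (componentCut G S).card ≤ ((Fintype.card V : ℝ) ^ (-k)) ^ S.card := by
  -- The other side of the cut has at least half of the vertices.
  have hcut : (s * S.card : ℝ) * Fintype.card V ≤ 2 * (componentCut G S).card := by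
    have h : s * S.card * Fintype.card V ≤ 2 * (componentCut G S).card := by
      rw [card_componentCut]
      calc s * S.card * Fintype.card V
          ≤ (componentVerts G S).card * (2 * (Fintype.card V - (componentVerts G S).card)) :=
            Nat.mul_le_mul (mul_card_le_card_componentVerts hcomp S) (by omega)
        _ = _ := by ring
    exact_mod_cast h
  calc (1 - q) ^ (componentCut G S).card
      ≤ Real.exp (-q) ^ (componentCut G S).card :=
        pow_le_pow_left₀ (by linarith) (Real.one_sub_le_exp_neg q) _
    _ = Real.exp (-(q * (componentCut G S).card)) := by rw [← Real.exp_nat_mul]; ring_nf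
    _ ≤ Real.exp (-(k * Real.log (Fintype.card V) * S.card)) := by
        refine Real.exp_le_exp.2 (neg_le_neg ?_)
        have h1 := mul_le_mul_of_nonneg_left hcut hq0
        have h2 := mul_le_mul_of_nonneg_right hqn (Nat.cast_nonneg (α := ℝ) S.card)
        linarith
    _ = ((Fintype.card V : ℝ) ^ (-k)) ^ S.card := by
        rw [Real.rpow_def_of_pos hV, ← Real.exp_nat_mul]; ring_nf

/-- If all components of a disconnected graph have at least `s` vertices, then adding
`(c + 2) * n * log n / s` random edges fails to connect it with probability at most `n ^ (-c)`. -/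
theorem randomAdd_real_not_connected_le_rpow [Nonempty V] {G : SimpleGraph V}
    (hG : ¬ G.Connected) {s : ℕ} (hs : 1 ≤ s)
    (hcomp : ∀ C : G.ConnectedComponent, s ≤ C.supp.ncard) {c t : ℝ} (hc : 0 ≤ c)
    (ht : (c + 2) * (Fintype.card V * Real.log (Fintype.card V) / s) ≤ t)
    (ht' : t ≤ numNonEdges G) :
    (randomAdd G t).real {H | ¬ H.Connected} ≤ (Fintype.card V : ℝ) ^ (-c) := by
  have hn2 : 2 ≤ Fintype.card V := by
    by_contra! h
    have : Subsingleton V := Fintype.card_le_one_iff_subsingleton.1 (by omega)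
    exact hG ⟨.of_subsingleton⟩
  set n := Fintype.card V with hn
  have hn0 : (0 : ℝ) < n := by positivity
  have hn1 : (2 : ℝ) ≤ n := by exact_mod_cast hn2
  have hs0 : (0 : ℝ) < s := by positivity
  have hlog : 0 < Real.log n := Real.log_pos (by linarith)
  have ht0 : 0 < t := lt_of_lt_of_le (by positivity) ht
  have hm0 : (0 : ℝ) < numNonEdges G := ht0.trans_le ht'
  have hm2 : 2 * (numNonEdges G : ℝ) ≤ n ^ 2 := by exact_mod_cast two_mul_numNonEdges_le G
  set q : ℝ := t / numNonEdges G with hq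
  have hq0 : 0 ≤ q := by positivity
  have hq1 : q ≤ 1 := (div_le_one hm0).2 ht'
  -- There are at most `n ^ 2 / 2` non-edges, so `q ≥ 2 * t / n ^ 2`.
  have hqn : 2 * (c + 2) * Real.log n ≤ q * (s * n) := by
    rw [hq, div_mul_eq_mul_div, le_div_iff₀ hm0]
    have h1 : (c + 2) * (n * Real.log n) ≤ t * s := by
      rwa [← mul_div_assoc, div_le_iff₀ hs0] at ht
    calc 2 * (c + 2) * Real.log n * numNonEdges G
        = (c + 2) * Real.log n * (2 * numNonEdges G) := by ring
      _ ≤ (c + 2) * Real.log n * n ^ 2 := by gcongr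
      _ = (c + 2) * (n * Real.log n) * n := by ring
      _ ≤ t * s * n := by gcongr
      _ = t * (s * n) := by ring
  -- The `2` in the exponent provides two factors `n`: one bounds the number of components, the
  -- other absorbs the `2` of the union bound, as `n ≥ 2`.
  set x : ℝ := (n : ℝ) ^ (-(c + 2)) with hx
  have hx0 : 0 < x := by positivity
  have hr : (Fintype.card G.ConnectedComponent : ℝ) ≤ n := by
    exact_mod_cast Fintype.card_le_of_surjective G.connectedComponentMk Quot.mk_surjective
  have hnx : n * (n * x) = (n : ℝ) ^ (-c) := by
    rw [hx, ← mul_assoc, ← sq, ← Real.rpow_natCast, ← Real.rpow_add hn0]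
    congr 1
    push_cast
    ring
  have hnx1 : (n : ℝ) ^ (-c) ≤ 1 := Real.rpow_le_one_of_one_le_of_nonpos (by linarith) (by linarith)
  have hnx2 : n * x ≤ 1 := by nlinarith [mul_pos hn0 hx0]
  have hrx : Fintype.card G.ConnectedComponent * x ≤ n * x :=
    mul_le_mul_of_nonneg_right hr hx0.le
  calc (randomAdd G t).real {H | ¬ H.Connected}
      ≤ _ := randomAdd_real_not_connected_le G t
    _ ≤ ∑ S : Finset G.ConnectedComponent with
          S.Nonempty ∧ 2 * (componentVerts G S).card ≤ n, x ^ S.card := by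
        refine Finset.sum_le_sum fun S hS => ?_
        rw [Set.projIcc_of_mem _ ⟨hq0, hq1⟩]
        exact one_sub_pow_card_componentCut_le hcomp hq0 hq1 hn0 hqn S
          (Finset.mem_filter.1 hS).2.2
    _ ≤ ∑ S ∈ (Finset.univ : Finset (Finset G.ConnectedComponent)).erase ∅, x ^ S.card := by
        refine Finset.sum_le_sum_of_subset_of_nonneg (fun S hS => ?_) fun _ _ _ => by positivity
        exact Finset.mem_erase.2 ⟨(Finset.mem_filter.1 hS).2.1.ne_empty, Finset.mem_univ _⟩
    _ ≤ 2 * (Fintype.card G.ConnectedComponent * x) :=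
        sum_pow_card_erase_empty_le hx0.le (hrx.trans hnx2)
    _ ≤ n * (n * x) := mul_le_mul hn1 hrx (by positivity) hn0.le
    _ = (n : ℝ) ^ (-c) := hnx

end Cut

/-- `A` is one algorithm for all graphs and all parameters. `C` is the constant in the running time
`O(s)`, `B a` the constant in the message length `O(log n)` when identifiers have at most `a` times
as many bits as `n`, and `K c` the constant in the distance `Ω((n log n) / s)` when stochastic
closeness is defined with the error probability `n ^ (-c)`. -/
theorem theorem1 :
    ∃ (A : CongestAlgorithm) (C : ℕ) (B : ℕ → ℕ) (K : ℝ → ℝ), (∀ c : ℝ, 1 < c → 0 < K c) ∧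
      ∀ (a n s : ℕ), 1 ≤ n → 1 ≤ s → ∀ (G : SimpleGraph (Fin n)) (N : Network G),
        (∀ v, (N.ident v).size ≤ a * n.size) →
          A.HaltsWithin N n s (C * s) ∧
          A.MessagesAtMost N n s (B a * n.size) ∧
          (G.Connected → ∀ v, A.Accepts N n s (C * s) v) ∧
          ∀ c : ℝ, 1 < c → ∀ t : ℝ, K c * (n * Real.log n / s) ≤ t → t ≤ numNonEdges G →
            StochasticallyFar c SimpleGraph.Connected G t →
              ∃ v, A.Rejects N n s (C * s) v := by
  refine ⟨gossip, 2, fun a => a + 1, fun c => c + 2, fun c hc => by linarith, ?_⟩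
  intro a n s hn hs G N hid
  have : Nonempty (Fin n) := ⟨⟨0, hn⟩⟩
  refine ⟨gossip.haltsWithin N n s, fun r v i => ?_, fun hG v => ?_, ?_⟩
  -- The start bit is absorbed because `n.size ≥ 1`.
  · have hsize : 0 < n.size := Nat.size_pos.2 hn
    calc _ ≤ a * n.size + 1 := gossip.messagesAtMost N n s hid r v i
      _ ≤ (a + 1) * n.size := by linarith
  · simpa using gossip.accepts N s hG v
  · rintro c hc t ht ht' ⟨hG, hfar⟩
    have hsmall : ∃ C : G.ConnectedComponent, C.supp.ncard < s := by
      by_contra! hcomp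
      refine hfar ⟨hG, ?_⟩
      simpa using randomAdd_real_not_connected_le_rpow hG hs hcomp (c := c) (by linarith)
        (by simpa using ht) ht'
    obtain ⟨C, hC⟩ := hsmall
    obtain ⟨v, rfl⟩ := C.exists_rep
    refine ⟨v, gossip.rejects N n s hC.le ?_⟩
    -- For `s > n` a component below size `s` could be everything; disconnectedness rules this out.
    by_contra! hge
    have huniv : (G.connectedComponentMk v).supp = Set.univ :=
      Set.eq_of_subset_of_ncard_le (Set.subset_univ _) (by simpa [Set.ncard_univ] using hge)
    have hreach : ∀ w, G.Reachable w v := fun w =>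
      SimpleGraph.ConnectedComponent.exact (huniv ▸ Set.mem_univ w : w ∈ _)
    exact hG ⟨fun u w => (hreach u).trans (hreach w).symm⟩
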